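/- For every $k\ge 1$ consider a ranking-and-selection problem with $k$ alternatives. Observations are independent, and those of alternative $i$ are normal with mean $\mu_i=\mu_i^{(k)}$ and variance $\sigma_i^2=(\sigma_i^{(k)})^2\ge 0$; $\mu_1$ and $\sigma_1^2$ do not depend on $k$. Let $\bar X_i(n)$ be the average of the first $n$ observations of alternative $i$. Suppose there are constants $\gamma>0$ and $\bar\sigma>0$ such that, for all $k$, $\mu_1-\mu_i\ge\gamma$ for $i=2,\dots,k$ and $\sigma_i^2\le\bar\sigma^2$ for $i=1,\dots,k$. The explore-first greedy procedure with exploration size $n_0\ge1$ and total budget $B$ first takes $n_0$ observations of each alternative; then, as long as fewer than $B$ observations have been taken, it takes the next one from an alternative whose current sample mean is largest; finally it selects an alternative with the largest sample mean. Ties are broken by an arbitrary fixed measurable rule. Let $\mathrm{PCS}$ be the probability that alternative $1$ is selected. For independent standard normal $Z_1,Z_2,\dots$ with $\bar Z(n)=\frac1n\sum_{j=1}^nZ_j$ put $C(x;n_0)=\mathrm E\left[\inf\{n\ge n_0:\bar Z(n)<x\}\right]\in[0,\infty]$. Let $n_0\ge 1$ be an integer, let $n_g$ be a real number with $n_g>C(\gamma/\bar\sigma;n_0)-n_0$,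 and let the budget for $k$ alternatives be $B=(n_0+n_g)k$, rounded up or down to an integer if it is not one. Then there is a $\gamma_0\in(0,\gamma)$ with $C\left(\frac{\gamma-\gamma_0}{\bar\sigma};n_0\right)=n_0+n_g$, and for any such $\gamma_0$ $$\liminf_{k\to\infty}\mathrm{PCS}\ \ge\ \Pr\left\{\min_{n\ge n_0}\bar X_1(n)>\mu_1-\gamma_0\right\}.$$ If moreover, for all $k$, $\mu_i=\mu_1-\gamma$ for $i=2,\dots,k$ and $\sigma_i^2=\bar\sigma^2$ for $i=1,\dots,k$ (slippage configuration with common variance $\bar\sigma^2$), then $$\lim_{k\to\infty}\mathrm{PCS}\ =\ \Pr\left\{\min_{n\ge n_0}\bar X_1(n)>\mu_1-\gamma_0\right\}.$$ -/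

import Mathlib

open MeasureTheory ProbabilityTheory Filter Topology
open scoped NNReal ENNReal

noncomputable section

namespace EFG

/-- The running average `(x 0 + ⋯ + x (n - 1)) / n` of the first `n` terms of `x`. -/
def runAvg (x : ℕ → ℝ) (n : ℕ) : ℝ := (∑ j ∈ Finset.range n, x j) / n

/-- The joint law of an infinite sequence of independent normal observations with mean `m` and
variance `v` (a point mass if `v = 0`). -/
def normalStream (m : ℝ) (v : ℝ≥0) : Measure (ℕ → ℝ) :=
  Measure.infinitePi fun _ : ℕ => gaussianReal m v

/-- The joint law of the observations of all alternatives: `x i j` is the `(j + 1)`-st observation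
of alternative `i`. All observations are independent, those of alternative `i` are normal with
mean `μ i` and variance `v i`. -/
def obsLaw {ι : Type*} [Fintype ι] (μ : ι → ℝ) (v : ι → ℝ≥0) : Measure (ι → ℕ → ℝ) :=
  Measure.pi fun i => normalStream (μ i) (v i)

/-- The first time `n ≥ n₀` at which the running average of `z` is below `b`; `∞` if there is
none. -/
def crossTime (n₀ : ℕ) (b : ℝ) (z : ℕ → ℝ) : ℝ≥0∞ :=
  ⨅ (n : ℕ) (_ : n₀ ≤ n ∧ runAvg z n < b), (n : ℝ≥0∞)

/-- `C(b; n₀) = E[inf {n ≥ n₀ : Z̄(n) < b}]` for independent standard normal observations. -/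
def C (b : ℝ) (n₀ : ℕ) : ℝ≥0∞ := ∫⁻ z, crossTime n₀ b z ∂(normalStream 0 1)

/-- `P{min_{n ≥ n₀} X̄(n) > b}` for independent normal observations with mean `m` and
variance `v`. The infimum is taken in the extended reals. -/
def probMinGT (m : ℝ) (v : ℝ≥0) (n₀ : ℕ) (b : ℝ) : ℝ≥0∞ :=
  normalStream m v {x | (b : EReal) < ⨅ (n : ℕ) (_ : n₀ ≤ n), ((runAvg x n : ℝ) : EReal)}

/-- `a` picks an index at which a vector is maximal (with some measurable tie-breaking). -/
def IsArgmaxRule {ι : Type*} [MeasurableSpace ι] (a : (ι → ℝ) → ι) : Prop :=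
  Measurable a ∧ ∀ (y : ι → ℝ) (i : ι), y i ≤ y (a y)

/-- The sample sizes of the alternatives after the exploration phase of `n₀` observations each and
`t` further observations, each taken from the alternative with the largest current running
average. -/
def sampleSize {ι : Type*} [DecidableEq ι] (a : (ι → ℝ) → ι) (n₀ : ℕ) (x : ι → ℕ → ℝ) :
    ℕ → ι → ℕ
  | 0 => fun _ => n₀
  | t + 1 =>
    let N := sampleSize a n₀ x t
    let s := a fun i => runAvg (x i) (N i)
    Function.update N s (N s + 1)

/-- The alternative that the explore-first greedy procedure with total budget `B` and exploration
size `n₀` selects: observations are taken greedily until the total number of observations is `B`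
(none, if the exploration phase has used up the budget), and then the alternative with the largest
running average is selected. -/
def selected {ι : Type*} [Fintype ι] [DecidableEq ι] (a : (ι → ℝ) → ι) (n₀ B : ℕ)
    (x : ι → ℕ → ℝ) : ι :=
  a fun i => runAvg (x i) (sampleSize a n₀ x (B - n₀ * Fintype.card ι) i)

/-- The probability of correct selection of the explore-first greedy procedure on `k + 1`
alternatives, the best of which has index `0`. -/
def PCS {k : ℕ} (μ : Fin (k + 1) → ℝ) (v : Fin (k + 1) → ℝ≥0)
    (a : (Fin (k + 1) → ℝ) → Fin (k + 1)) (n₀ B : ℕ) : ℝ≥0∞ :=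
  obsLaw μ v {x | selected a n₀ B x = 0}

end EFG

end

namespace EFG

/-! Let `M` be the minimum of the running averages of alternative 1. A competitor whose average
drops below `M` is never sampled again, so it uses at most its crossing time of level `M`. After
standardization this is at most the crossing time of `(M - μ₁ + γ) / σbar`, with mean `C` at that
level, and by the law of large numbers the competitors together need at most about `k` times this
mean. If `M > μ₁ - γ₀`, strict monotonicity of `C` puts the mean below `n₀ + n_g`: the budget lets
alternative 1 be sampled at its minimum, and from then on it beats all others
(`sampled_eq_of_sum_lt`).

In the slippage configuration with `M < μ₁ - γ₀`, alternative 1 falls at some fixed time below a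
level to which the budget cannot bring all competitors. Some competitor therefore stays ahead and
alternative 1 is abandoned (`sampled_ne_of_lt_sum`). The case `M = μ₁ - γ₀` is null.

For `γ₀` to exist, `C` must be finite and continuous on the positive reals and unbounded near 0. The
last point follows from `C 0 n₀ = ⊤`, that is, from recurrence of the walk and Wald's identity. All
rows are coupled on one probability space, so both cases are almost sure statements for large `k`,
and convergence of probabilities follows from that of indicators. -/

/-! ### Running averages of a standard normal sequence -/

instance isProbabilityMeasure_normalStream (m : ℝ) (v : ℝ≥0) :
    IsProbabilityMeasure (normalStream m v) := by
  unfold normalStream; infer_instance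

lemma measurable_runAvg (n : ℕ) : Measurable fun x : ℕ → ℝ => runAvg x n := by
  unfold runAvg; fun_prop

lemma map_eval_normalStream (m : ℝ) (v : ℝ≥0) (j : ℕ) :
    (normalStream m v).map (fun z => z j) = gaussianReal m v :=
  Measure.infinitePi_map_eval (fun _ : ℕ => gaussianReal m v) j

lemma iIndepFun_normalStream (m : ℝ) (v : ℝ≥0) :
    iIndepFun (fun (j : ℕ) (z : ℕ → ℝ) => z j) (normalStream m v) :=
  iIndepFun_infinitePi (X := fun _ ω => ω) (by fun_prop)

lemma map_sum_normalStream (s : Finset ℕ) :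
    (normalStream 0 1).map (fun z => ∑ j ∈ s, z j) = gaussianReal 0 s.card := by
  classical
  induction s using Finset.induction_on with
  | empty => simp [Measure.map_const]
  | insert a s ha ih =>
    have hind := (iIndepFun_normalStream 0 1).indepFun_finsetSum_of_notMem
      (fun i => by fun_prop) ha
    have hs : (∑ j ∈ s, fun z : ℕ → ℝ => z j) = fun z => ∑ j ∈ s, z j := by
      ext z; simp
    rw [hs] at hind
    have := gaussianReal_add_gaussianReal_of_indepFun hind ih (map_eval_normalStream 0 1 a)
    simp only [Finset.sum_insert ha, Finset.card_insert_of_notMem ha]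
    convert! this using 2
    · ext z; simp [add_comm]
    · simp
    · simp

lemma map_runAvg_normalStream (n : ℕ) :
    (normalStream 0 1).map (fun z => runAvg z n) =
      gaussianReal 0 ((n : ℝ≥0) / ⟨(n : ℝ) ^ 2, sq_nonneg _⟩) := by
  have h : (fun z : ℕ → ℝ => runAvg z n) = (fun y => y / (n : ℝ)) ∘
      fun z : ℕ → ℝ => ∑ j ∈ Finset.range n, z j := rfl
  rw [h, ← Measure.map_map (by fun_prop) (by fun_prop), map_sum_normalStream,
    gaussianReal_map_div_const]
  simp; rfl

lemma var_runAvg_ne_zero {n : ℕ} (hn : 1 ≤ n) :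
    ((n : ℝ≥0) / ⟨(n : ℝ) ^ 2, sq_nonneg _⟩) ≠ 0 := by
  have h0 : n ≠ 0 := by omega
  refine div_ne_zero (by exact_mod_cast h0) fun h => ?_
  have h2 : (n : ℝ) ^ 2 = 0 := congrArg NNReal.toReal h
  simp [h0] at h2

lemma ae_runAvg_ne {n : ℕ} (hn : 1 ≤ n) (b : ℝ) :
    ∀ᵐ z ∂normalStream 0 1, runAvg z n ≠ b := by
  have := nullSingletonClass_gaussianReal (μ := 0) (var_runAvg_ne_zero hn)
  have h : ∀ᵐ y ∂(normalStream 0 1).map (fun z => runAvg z n), y ≠ b := by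
    rw [map_runAvg_normalStream]
    exact Measure.ae_ne _ b
  exact ae_of_ae_map (measurable_runAvg n).aemeasurable h

lemma runAvg_mem_Ioo_pos {n : ℕ} (hn : 1 ≤ n) {b c : ℝ} (hbc : b < c) :
    0 < normalStream 0 1 {z | runAvg z n ∈ Set.Ioo b c} := by
  have h := Measure.map_apply (μ := normalStream 0 1) (measurable_runAvg n)
    (measurableSet_Ioo (a := b) (b := c))
  rw [map_runAvg_normalStream] at h
  change 0 < normalStream 0 1 ((fun z => runAvg z n) ⁻¹' Set.Ioo b c)
  rw [← h, pos_iff_ne_zero]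
  intro h0
  have := gaussianReal_absolutelyContinuous' 0 (var_runAvg_ne_zero hn) h0
  simp [Real.volume_Ioo] at this
  linarith

lemma integrable_eval_normalStream (j : ℕ) :
    Integrable (fun z : ℕ → ℝ => z j) (normalStream 0 1) := by
  have h : Integrable (fun y : ℝ => y) ((normalStream 0 1).map fun z => z j) := by
    rw [map_eval_normalStream]
    exact (memLp_id_gaussianReal 1).integrable (by simp)
  exact h.comp_measurable (by fun_prop)

lemma integral_eval_normalStream (j : ℕ) : ∫ z, z j ∂normalStream 0 1 = 0 := by
  have h := integral_map (μ := normalStream 0 1) (φ := fun z : ℕ → ℝ => z j) (f := fun y : ℝ => y)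
    (measurable_pi_apply j).aemeasurable (by fun_prop)
  rw [← h, map_eval_normalStream, integral_id_gaussianReal]

lemma ae_tendsto_runAvg :
    ∀ᵐ z ∂normalStream 0 1, Tendsto (fun n => runAvg z n) atTop (𝓝 0) := by
  have h := strong_law_ae_real (μ := normalStream 0 1) (fun (j : ℕ) (z : ℕ → ℝ) => z j)
    (integrable_eval_normalStream 0)
    (fun i j hij => (iIndepFun_normalStream 0 1).indepFun hij)
    (fun i => ⟨(measurable_pi_apply i).aemeasurable, (measurable_pi_apply 0).aemeasurable, by
      rw [map_eval_normalStream, map_eval_normalStream]⟩)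
  simpa only [integral_eval_normalStream, runAvg] using h

/-- Chernoff bound; its summability in `n` makes `C` finite at positive levels. -/
lemma runAvg_ge_le_exp {b : ℝ} (hb : 0 < b) (n : ℕ) :
    normalStream 0 1 {z | b ≤ runAvg z n} ≤ ENNReal.ofReal (Real.exp (-(b ^ 2 / 2) * n)) := by
  rcases Nat.eq_zero_or_pos n with rfl | hn
  · simpa using prob_le_one
  have hsub : ∀ i < n, HasSubgaussianMGF (fun z : ℕ → ℝ => z i) 1 (normalStream 0 1) := by
    intro i _
    have hm := map_eval_normalStream 0 1 i
    refine ⟨fun t => ?_, fun t => ?_⟩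
    · have h : Integrable (fun y : ℝ => Real.exp (t * y))
          ((normalStream 0 1).map fun z => z i) := by
        rw [hm]; exact integrable_exp_mul_gaussianReal t
      exact h.comp_measurable (by fun_prop)
    · rw [mgf_gaussianReal hm]; simp
  have h := HasSubgaussianMGF.measure_sum_range_ge_le_of_iIndepFun (iIndepFun_normalStream 0 1)
    hsub (ε := b * n) (by positivity)
  have hn' : (0 : ℝ) < n := by exact_mod_cast hn
  have he : -(b * n) ^ 2 / (2 * n * (1 : ℝ≥0)) = -(b ^ 2 / 2) * n := by
    simp; field_simp
  rw [he] at h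
  have hset : {z : ℕ → ℝ | b ≤ runAvg z n} =
      {z | b * n ≤ ∑ i ∈ Finset.range n, z i} := by
    ext z; simp only [Set.mem_ofPred_eq, runAvg, le_div_iff₀ hn']
  rw [hset, ← ofReal_measureReal]
  exact ENNReal.ofReal_le_ofReal h

/-! ### The centred walk becomes negative -/

/-- The sequence that agrees with `z` on `[i, j)` and vanishes elsewhere. -/
def block (i j : ℕ) (z : ℕ → ℝ) : ℕ → ℝ := fun n => if i ≤ n ∧ n < j then z n else 0

/-- Padding by zeros keeps past and future of type `ℕ → ℝ`, so events such as `stayGE` apply to them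
unchanged. -/
lemma indepFun_block (i j : ℕ) :
    IndepFun (block 0 i) (block i j) (normalStream 0 1) := by
  have h := (iIndepFun_normalStream 0 1).indepFun_finset (Finset.range i) (Finset.Ico i j)
    (by
      rw [Finset.disjoint_left]
      intro a ha hb
      simp at ha hb; omega) (fun i => by fun_prop)
  let ext (s : Finset ℕ) (y : s → ℝ) : ℕ → ℝ := fun n => if h : n ∈ s then y ⟨n, h⟩ else 0
  have hext (s : Finset ℕ) : Measurable (ext s) := by
    refine measurable_pi_lambda _ fun n => ?_
    by_cases hn : n ∈ s <;> simp only [ext, hn, dite_true, dite_false] <;> fun_prop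
  have h' := h.comp (hext _) (hext _)
  convert! h' using 1 <;>
  · ext z n
    simp [block, ext]

lemma runAvg_congr {x y : ℕ → ℝ} {n : ℕ} (h : ∀ j < n, x j = y j) : runAvg x n = runAvg y n := by
  unfold runAvg
  congr 1
  exact Finset.sum_congr rfl fun j hj => h j (Finset.mem_range.1 hj)

lemma runAvg_block {i n : ℕ} (h : n ≤ i) (z : ℕ → ℝ) : runAvg (block 0 i z) n = runAvg z n :=
  runAvg_congr fun j hj => by simp [block, lt_of_lt_of_le hj h]

/-- The sequences whose running averages are at least `b` from time `n₀` to time `j`. -/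
def stayGE (n₀ : ℕ) (b : ℝ) (j : ℕ) : Set (ℕ → ℝ) := {z | ∀ n, n₀ ≤ n → n ≤ j → b ≤ runAvg z n}

lemma measurableSet_stayGE (n₀ : ℕ) (b : ℝ) (j : ℕ) : MeasurableSet (stayGE n₀ b j) := by
  have : stayGE n₀ b j = ⋂ n, ⋂ (_ : n₀ ≤ n), ⋂ (_ : n ≤ j), {z | b ≤ runAvg z n} := by
    ext z; simp [stayGE]
  rw [this]
  exact .iInter fun n => .iInter fun _ => .iInter fun _ =>
    measurableSet_le measurable_const (measurable_runAvg n)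

lemma block_mem_stayGE {n₀ j : ℕ} {b : ℝ} {z : ℕ → ℝ} :
    block 0 j z ∈ stayGE n₀ b j ↔ z ∈ stayGE n₀ b j :=
  forall_congr' fun n => forall_congr' fun _ => forall_congr' fun h => by rw [runAvg_block h]

lemma antitone_stayGE (n₀ : ℕ) (b : ℝ) : Antitone (stayGE n₀ b) :=
  fun _ _ hij _ hz n h1 h2 => hz n h1 (h2.trans hij)

/-- If the walk is at most `K` at time `N` and nonnegative `K ^ 2` steps later, the increment
divided by `K` is at least `-1`. This quotient is standard normal and independent of the first `N`
terms. -/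
lemma measure_stayGE_step (n₀ N K : ℕ) (hK : 1 ≤ K) (hN : n₀ ≤ N) :
    normalStream 0 1 (stayGE n₀ 0 (N + K ^ 2)) ≤
      normalStream 0 1 (stayGE n₀ 0 N) * gaussianReal 0 1 (Set.Ici (-1)) +
      normalStream 0 1 {z | (K : ℝ) < ∑ j ∈ Finset.range N, z j} := by
  set W : (ℕ → ℝ) → ℝ := fun z => (∑ j ∈ Finset.Ico N (N + K ^ 2), z j) / K with hW
  have hWm : Measurable W := by fun_prop
  have hK0 : (0 : ℝ) < K := by exact_mod_cast hK
  have hlaw : (normalStream 0 1).map W = gaussianReal 0 1 := by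
    have h : W = (fun y => y / (K : ℝ)) ∘
      fun z : ℕ → ℝ => ∑ j ∈ Finset.Ico N (N + K ^ 2), z j := rfl
    rw [h, ← Measure.map_map (by fun_prop) (by fun_prop), map_sum_normalStream,
      gaussianReal_map_div_const]
    congr 1
    · simp
    · ext; simp [hK0.ne']
  have hind : normalStream 0 1 (stayGE n₀ 0 N ∩ W ⁻¹' Set.Ici (-1)) =
      normalStream 0 1 (stayGE n₀ 0 N) * gaussianReal 0 1 (Set.Ici (-1)) := by
    have h := (indepFun_block N (N + K ^ 2)).measure_inter_preimage_eq_mul _ _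
      (measurableSet_stayGE n₀ 0 N) (hWm (measurableSet_Ici (a := (-1 : ℝ))))
    have h1 : block 0 N ⁻¹' stayGE n₀ 0 N = stayGE n₀ 0 N := by
      ext z; exact block_mem_stayGE
    have h2 : block N (N + K ^ 2) ⁻¹' (W ⁻¹' Set.Ici (-1)) = W ⁻¹' Set.Ici (-1) := by
      ext z
      have : W (block N (N + K ^ 2) z) = W z := by
        simp only [hW]
        congr 1
        refine Finset.sum_congr rfl fun j hj => ?_
        simp only [block, if_pos (Finset.mem_Ico.1 hj)]
      simp only [Set.mem_preimage, this]
    rw [h1, h2] at h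
    rw [h, ← hlaw, Measure.map_apply hWm measurableSet_Ici]
  rw [← hind]
  refine (measure_mono fun z hz => ?_).trans (measure_union_le _ _)
  by_cases hS : (K : ℝ) < ∑ j ∈ Finset.range N, z j
  · exact Or.inr hS
  refine Or.inl ⟨antitone_stayGE n₀ 0 (Nat.le_add_right _ _) hz, ?_⟩
  have h0 := hz (N + K ^ 2) (by omega) le_rfl
  have hpos : (0 : ℝ) < ((N + K ^ 2 : ℕ) : ℝ) := by positivity
  rw [runAvg, le_div_iff₀ hpos, zero_mul,
    ← Finset.sum_range_add_sum_Ico _ (Nat.le_add_right N (K ^ 2))] at h0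
  simp only [Set.mem_preimage, Set.mem_Ici, hW, le_div_iff₀ hK0]
  linarith

lemma ae_exists_runAvg_neg (n₀ : ℕ) :
    ∀ᵐ z ∂normalStream 0 1, ∃ n, n₀ ≤ n ∧ runAvg z n < 0 := by
  set ν := normalStream 0 1
  set c := gaussianReal 0 1 (Set.Ici (-1))
  have hc : c < 1 := by
    have h : c + gaussianReal 0 1 (Set.Ici (-1))ᶜ = 1 :=
      (measure_add_measure_compl measurableSet_Ici).trans measure_univ
    have hpos : gaussianReal 0 1 (Set.Ici (-1))ᶜ ≠ 0 := by
      intro h0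
      have := gaussianReal_absolutelyContinuous' 0 one_ne_zero h0
      simp at this
    have hfin : c ≠ ⊤ := measure_ne_top _ _
    rw [← h]
    exact ENNReal.lt_add_right hfin hpos
  -- Letting first `K`, then `N` tend to infinity in the one-step bound gives `ν A ≤ ν A * c` with
  -- `c < 1`.
  set A := ⋂ N, stayGE n₀ 0 N
  have hstep (N : ℕ) (hN : n₀ ≤ N) : ν A ≤ ν (stayGE n₀ 0 N) * c := by
    have hlim : Tendsto (fun K : ℕ => ν {z | (K : ℝ) < ∑ j ∈ Finset.range N, z j}) atTop
        (𝓝 0) := by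
      have h := tendsto_measure_iInter_atTop (μ := ν)
        (s := fun K : ℕ => {z : ℕ → ℝ | (K : ℝ) < ∑ j ∈ Finset.range N, z j})
        (fun K => (measurableSet_lt measurable_const (by fun_prop)).nullMeasurableSet)
        (fun i j hij z (hz : (j : ℝ) < _) => show (i : ℝ) < _ from
          lt_of_le_of_lt (Nat.cast_le.2 hij) hz) ⟨0, measure_ne_top _ _⟩
      have he : (⋂ K : ℕ, {z : ℕ → ℝ | (K : ℝ) < ∑ j ∈ Finset.range N, z j}) = ∅ := by
        ext z
        simp only [Set.mem_iInter, Set.mem_ofPred_eq, Set.mem_empty_iff_false, iff_false, not_forall,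
          not_lt]
        exact exists_nat_ge _
      rwa [he, measure_empty] at h
    have := (tendsto_const_nhds (x := ν (stayGE n₀ 0 N) * c)).add hlim
    rw [add_zero] at this
    refine ge_of_tendsto this ?_
    filter_upwards [eventually_ge_atTop 1] with K hK
    exact (measure_mono (Set.iInter_subset _ _)).trans (measure_stayGE_step n₀ N K hK hN)
  have hlim : Tendsto (fun N => ν (stayGE n₀ 0 N)) atTop (𝓝 (ν A)) :=
    tendsto_measure_iInter_atTop (fun N => (measurableSet_stayGE n₀ 0 N).nullMeasurableSet)
      (antitone_stayGE n₀ 0) ⟨0, measure_ne_top _ _⟩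
  have hle : ν A ≤ ν A * c := by
    refine ge_of_tendsto (ENNReal.Tendsto.mul_const hlim (Or.inr (measure_ne_top _ _))) ?_
    filter_upwards [eventually_ge_atTop n₀] with N hN using hstep N hN
  have hA : ν A = 0 := by
    by_contra h
    have : ν A * c < ν A * 1 := ENNReal.mul_lt_mul_right h (measure_ne_top _ _) hc
    rw [mul_one] at this
    exact absurd hle (not_le.2 this)
  rw [ae_iff]
  convert! hA using 2
  ext z
  simp only [Set.mem_ofPred_eq, not_exists, not_and, not_lt, A, Set.mem_iInter, stayGE]
  exact ⟨fun h N n h1 _ => h n h1, fun h n h1 => h n n h1 le_rfl⟩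

/-! ### Crossing times and the function `C` -/

/-- `N` is the first time `n ≥ n₀` at which the running average of `z` is below `b`. -/
def IsFirstBelow (n₀ : ℕ) (b : ℝ) (z : ℕ → ℝ) (N : ℕ) : Prop :=
  n₀ ≤ N ∧ runAvg z N < b ∧ ∀ n, n₀ ≤ n → n < N → b ≤ runAvg z n

lemma exists_isFirstBelow {n₀ : ℕ} {b : ℝ} {z : ℕ → ℝ} (h : ∃ n, n₀ ≤ n ∧ runAvg z n < b) :
    ∃ N, IsFirstBelow n₀ b z N := by
  classical
  refine ⟨Nat.find h, (Nat.find_spec h).1, (Nat.find_spec h).2, fun n h1 h2 => ?_⟩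
  by_contra h3
  exact Nat.find_min h h2 ⟨h1, not_le.1 h3⟩

lemma crossTime_le {n₀ : ℕ} {b : ℝ} {z : ℕ → ℝ} {n : ℕ} (h : n₀ ≤ n) (h' : runAvg z n < b) :
    crossTime n₀ b z ≤ n :=
  iInf₂_le (f := fun (n : ℕ) (_ : n₀ ≤ n ∧ runAvg z n < b) => (n : ℝ≥0∞)) n ⟨h, h'⟩

lemma IsFirstBelow.crossTime_eq {n₀ : ℕ} {b : ℝ} {z : ℕ → ℝ} {N : ℕ}
    (h : IsFirstBelow n₀ b z N) : crossTime n₀ b z = N := by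
  refine le_antisymm (crossTime_le h.1 h.2.1) (le_iInf₂ fun n hn => ?_)
  by_contra hlt
  exact absurd (h.2.2 n hn.1 (Nat.cast_lt.1 (not_le.1 hlt))) (not_le.2 hn.2)

lemma crossTime_eq_top {n₀ : ℕ} {b : ℝ} {z : ℕ → ℝ} (h : ∀ n, n₀ ≤ n → b ≤ runAvg z n) :
    crossTime n₀ b z = ⊤ := by
  simp only [crossTime, iInf_eq_top]
  exact fun n hn => absurd (h n hn.1) (not_le.2 hn.2)

lemma exists_isFirstBelow_of_ne_top {n₀ : ℕ} {b : ℝ} {z : ℕ → ℝ} (h : crossTime n₀ b z ≠ ⊤) :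
    ∃ N, IsFirstBelow n₀ b z N := by
  refine exists_isFirstBelow ?_
  by_contra hne
  push Not at hne
  exact h (crossTime_eq_top hne)

lemma IsFirstBelow.mem_stayGE_iff {n₀ : ℕ} {b : ℝ} {z : ℕ → ℝ} {N : ℕ}
    (h : IsFirstBelow n₀ b z N) (j : ℕ) : z ∈ stayGE n₀ b j ↔ j < N := by
  refine ⟨fun hz => ?_, fun hj n h1 h2 => h.2.2 n h1 (by omega)⟩
  by_contra hj
  exact absurd (hz N h.1 (not_lt.1 hj)) (not_le.2 h.2.1)

lemma IsFirstBelow.tsum_indicator {n₀ : ℕ} {b : ℝ} {z : ℕ → ℝ} {N : ℕ}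
    (h : IsFirstBelow n₀ b z N) {M : Type*} [AddCommMonoid M] [TopologicalSpace M]
    (f : ℕ → (ℕ → ℝ) → M) :
    ∑' j, (stayGE n₀ b j).indicator (f j) z = ∑ j ∈ Finset.range N, f j z := by
  rw [tsum_eq_sum (s := Finset.range N)]
  · refine Finset.sum_congr rfl fun j hj => ?_
    rw [Set.indicator_of_mem ((h.mem_stayGE_iff j).2 (Finset.mem_range.1 hj))]
  · intro j hj
    rw [Set.indicator_of_notMem]
    rw [h.mem_stayGE_iff]
    simpa using hj

/-- Tail-sum formula: the crossing time exceeds `j` exactly on `stayGE n₀ b j`, which is everything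
for `j < n₀`. -/
lemma crossTime_eq_tsum (n₀ : ℕ) (b : ℝ) (z : ℕ → ℝ) :
    crossTime n₀ b z = ∑' j, (stayGE n₀ b j).indicator (fun _ => (1 : ℝ≥0∞)) z := by
  by_cases h : ∃ n, n₀ ≤ n ∧ runAvg z n < b
  · obtain ⟨N, hN⟩ := exists_isFirstBelow h
    rw [hN.crossTime_eq, hN.tsum_indicator]
    simp
  · push Not at h
    rw [crossTime_eq_top h]
    have : ∀ j, (stayGE n₀ b j).indicator (fun _ => (1 : ℝ≥0∞)) z = 1 := fun j =>
      Set.indicator_of_mem (show z ∈ stayGE n₀ b j from fun n h1 _ => h n h1) _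
    simp [this]

lemma measurable_crossTime (n₀ : ℕ) (b : ℝ) : Measurable (crossTime n₀ b) := by
  have : crossTime n₀ b = fun z => ∑' j, (stayGE n₀ b j).indicator (fun _ => (1 : ℝ≥0∞)) z :=
    funext (crossTime_eq_tsum n₀ b)
  rw [this]
  exact Measurable.tsum fun j => measurable_const.indicator (measurableSet_stayGE n₀ b j)

lemma C_eq_tsum (b : ℝ) (n₀ : ℕ) : C b n₀ = ∑' j, normalStream 0 1 (stayGE n₀ b j) := by
  simp only [C, crossTime_eq_tsum]
  rw [lintegral_tsum fun j =>
    (measurable_const.indicator (measurableSet_stayGE n₀ b j)).aemeasurable]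
  refine tsum_congr fun j => ?_
  rw [lintegral_indicator_const (measurableSet_stayGE n₀ b j), one_mul]

lemma crossTime_antitone (n₀ : ℕ) (z : ℕ → ℝ) : Antitone fun b => crossTime n₀ b z :=
  fun _ _ hbc => le_iInf₂ fun _ hn => crossTime_le hn.1 (hn.2.trans_le hbc)

lemma C_antitone (n₀ : ℕ) : Antitone fun b => C b n₀ :=
  fun _ _ hbc => lintegral_mono fun z => crossTime_antitone n₀ z hbc

lemma natCast_le_crossTime (n₀ : ℕ) (b : ℝ) (z : ℕ → ℝ) : (n₀ : ℝ≥0∞) ≤ crossTime n₀ b z :=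
  le_iInf₂ fun _ hn => Nat.cast_le.2 hn.1

lemma natCast_le_C (b : ℝ) (n₀ : ℕ) : (n₀ : ℝ≥0∞) ≤ C b n₀ := by
  have := lintegral_mono (μ := normalStream 0 1) fun z => natCast_le_crossTime n₀ b z
  simpa [C] using this

lemma C_ne_top {b : ℝ} (hb : 0 < b) (n₀ : ℕ) : C b n₀ ≠ ⊤ := by
  rw [C_eq_tsum, ← Summable.sum_add_tsum_nat_add' (k := n₀) ENNReal.summable]
  refine ENNReal.add_ne_top.2 ⟨(ENNReal.sum_lt_top.2 fun _ _ => measure_lt_top _ _).ne, ?_⟩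
  have hs : Summable fun n : ℕ => Real.exp (-(b ^ 2 / 2) * ((n + n₀ : ℕ) : ℝ)) := by
    refine (summable_nat_add_iff (f := fun n : ℕ => Real.exp (-(b ^ 2 / 2) * (n : ℝ))) n₀).2 ?_
    have := (Real.summable_exp_nat_mul_iff (a := -(b ^ 2 / 2))).2 (by nlinarith)
    simpa [mul_comm] using this
  refine ne_top_of_le_ne_top hs.tsum_ofReal_ne_top (ENNReal.tsum_le_tsum fun j => ?_)
  exact (measure_mono fun z (hz : z ∈ stayGE n₀ b (j + n₀)) =>
    hz (j + n₀) (Nat.le_add_left _ _) le_rfl).trans (runAvg_ge_le_exp hb _)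

lemma ae_crossTime_ne_top {b : ℝ} (hb : 0 < b) (n₀ : ℕ) :
    ∀ᵐ z ∂normalStream 0 1, crossTime n₀ b z ≠ ⊤ := by
  filter_upwards [ae_lt_top (measurable_crossTime n₀ b) (C_ne_top hb n₀)] with z hz using hz.ne

/-- Staying up to time `j` depends only on the terms before `z j`, because indexing starts at 0. It
is thus independent of `z j`, as Wald's identity requires. -/
lemma integral_indicator_stayGE (n₀ : ℕ) (b : ℝ) (j : ℕ) :
    ∫ z, (stayGE n₀ b j).indicator (fun z => z j) z ∂normalStream 0 1 = 0 ∧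
    ∫ z, ‖(stayGE n₀ b j).indicator (fun z => z j) z‖ ∂normalStream 0 1 =
      (normalStream 0 1).real (stayGE n₀ b j) * ∫ z, |z 0| ∂normalStream 0 1 := by
  set g : (ℕ → ℝ) → ℝ := (stayGE n₀ b j).indicator fun _ => 1 with hg
  have hgm : Measurable g := measurable_const.indicator (measurableSet_stayGE n₀ b j)
  have hgb (z : ℕ → ℝ) : g (block 0 j z) = g z := by
    by_cases hz : z ∈ stayGE n₀ b j
    · simp only [hg, Set.indicator_of_mem hz, Set.indicator_of_mem (block_mem_stayGE.2 hz)]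
    · simp only [hg, Set.indicator_of_notMem hz,
        Set.indicator_of_notMem (fun h => hz (block_mem_stayGE.1 h))]
  have hind : IndepFun g (fun z : ℕ → ℝ => z j) (normalStream 0 1) := by
    have h := (indepFun_block j (j + 1)).comp hgm (measurable_pi_apply j)
    convert! h using 1
    · ext z; exact (hgb z).symm
    · ext z; simp [block]
  have hgi : ∫ z, g z ∂normalStream 0 1 = (normalStream 0 1).real (stayGE n₀ b j) := by
    rw [hg, integral_indicator_const _ (measurableSet_stayGE n₀ b j)]; simp
  have he (z : ℕ → ℝ) : (stayGE n₀ b j).indicator (fun z => z j) z = g z * z j := by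
    by_cases hz : z ∈ stayGE n₀ b j <;> simp [hg, hz]
  have hne (z : ℕ → ℝ) : ‖(stayGE n₀ b j).indicator (fun z => z j) z‖ = g z * |z j| := by
    by_cases hz : z ∈ stayGE n₀ b j <;> simp [hg, hz]
  constructor
  · simp only [he]
    rw [hind.integral_fun_mul_eq_mul_integral hgm.aestronglyMeasurable
      (measurable_pi_apply j).aestronglyMeasurable, integral_eval_normalStream, mul_zero]
  · simp only [hne]
    have hind' : IndepFun g (fun z : ℕ → ℝ => |z j|) (normalStream 0 1) :=
      hind.comp measurable_id (measurable_norm (α := ℝ))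
    have habs (i : ℕ) : ∫ z, |z i| ∂normalStream 0 1 = ∫ y, |y| ∂gaussianReal 0 1 := by
      rw [← map_eval_normalStream 0 1 i,
        integral_map (measurable_pi_apply i).aemeasurable (by fun_prop)]
    rw [hind'.integral_fun_mul_eq_mul_integral hgm.aestronglyMeasurable
      (measurable_norm.comp (measurable_pi_apply j)).aestronglyMeasurable, hgi, habs j, habs 0]

/-- By Wald's identity, the first time a centred normal random walk is negative is not
integrable. -/
lemma C_zero {n₀ : ℕ} (hn₀ : 1 ≤ n₀) : C 0 n₀ = ⊤ := by
  by_contra hC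
  set ν := normalStream 0 1
  -- The sum of the `F j` is the walk stopped at the crossing time. If `C 0 n₀` were finite, its
  -- mean would be zero, yet it is almost surely negative.
  set F : ℕ → (ℕ → ℝ) → ℝ := fun j => (stayGE n₀ 0 j).indicator fun z => z j
  have hint (j : ℕ) : Integrable (F j) ν :=
    (integrable_eval_normalStream j).indicator (measurableSet_stayGE n₀ 0 j)
  have hsum : Summable fun j => ∫ z, ‖F j z‖ ∂ν := by
    simp only [F, ν, (integral_indicator_stayGE n₀ 0 _).2]
    refine Summable.mul_right _ ?_
    refine ENNReal.summable_toReal ?_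
    rw [← C_eq_tsum]; exact hC
  have hzero : ∫ z, ∑' j, F j z ∂ν = 0 := by
    rw [← integral_tsum_of_summable_integral_norm hint hsum]
    simp only [F, ν, (integral_indicator_stayGE n₀ 0 _).1, tsum_zero]
  have hneg : ∀ᵐ z ∂ν, ∑' j, F j z < 0 := by
    filter_upwards [ae_exists_runAvg_neg n₀] with z hz
    obtain ⟨N, hN⟩ := exists_isFirstBelow hz
    rw [hN.tsum_indicator]
    have hpos : (0 : ℝ) < N := by exact_mod_cast hn₀.trans hN.1
    have := hN.2.1
    rwa [runAvg, div_lt_iff₀ hpos, zero_mul] at this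
  have hI : Integrable (fun z => ∑' j, F j z) ν := by
    have hlt : ∫⁻ z, ∑' j, ‖F j z‖ₑ ∂ν ≠ ⊤ := by
      rw [lintegral_tsum fun j => (hint j).aestronglyMeasurable.enorm]
      have : ∀ j, ∫⁻ z, ‖F j z‖ₑ ∂ν = ENNReal.ofReal (∫ z, ‖F j z‖ ∂ν) := fun j =>
        (ofReal_integral_norm_eq_lintegral_enorm (hint j)).symm
      simp only [this]
      exact hsum.tsum_ofReal_ne_top
    refine ⟨?_, ?_⟩
    · exact (Measurable.tsum fun j =>
        (measurable_pi_apply j).indicator (measurableSet_stayGE n₀ 0 j)).aestronglyMeasurable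
    · refine lt_of_le_of_lt (lintegral_mono fun z => ?_) hlt.lt_top
      exact enorm_tsum_le_tsum_enorm
  have h0 : (fun z => -∑' j, F j z) =ᵐ[ν] 0 := by
    refine (integral_eq_zero_iff_of_nonneg_ae ?_ hI.neg).1 ?_
    · filter_upwards [hneg] with z hz
      simpa using hz.le
    · change ∫ z, -∑' j, F j z ∂ν = 0
      rw [integral_neg, hzero, neg_zero]
  obtain ⟨z, h1, h2⟩ := (hneg.and h0).exists
  simp only [Pi.zero_apply, neg_eq_zero] at h2
  exact h1.ne h2

/-- If the average at time `n₀` lies between the levels, which has positive probability, `c` is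
crossed at once and `b` only later. Positivity of `c` makes the smaller integral finite. -/
lemma C_strictAnti {n₀ : ℕ} (hn₀ : 1 ≤ n₀) {b c : ℝ} (hc : 0 < c) (hbc : b < c) :
    C c n₀ < C b n₀ := by
  refine lintegral_strict_mono_of_ae_le_of_ae_lt_on (s := {z | runAvg z n₀ ∈ Set.Ioo b c})
    (measurable_crossTime n₀ b).aemeasurable (C_ne_top hc n₀)
    (Eventually.of_forall fun z => crossTime_antitone n₀ z hbc.le)
    (runAvg_mem_Ioo_pos hn₀ hbc).ne' (Eventually.of_forall fun z hz => ?_)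
  have hz' : b < runAvg z n₀ ∧ runAvg z n₀ < c := hz
  refine (crossTime_le le_rfl hz'.2).trans_lt ?_
  refine lt_of_lt_of_le (b := ((n₀ + 1 : ℕ) : ℝ≥0∞)) (by exact_mod_cast Nat.lt_succ_self n₀) ?_
  refine le_iInf₂ fun n hn => Nat.cast_le.2 ?_
  rcases hn.1.eq_or_lt with rfl | h
  · exact absurd hn.2 (not_lt.2 hz'.1.le)
  · exact h

/-- Off the ties, a first crossing is described by finitely many strict inequalities, an open
condition on the level. -/
lemma eventually_isFirstBelow {n₀ : ℕ} {b : ℝ} {z : ℕ → ℝ} {N : ℕ} (h : IsFirstBelow n₀ b z N)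
    (hne : ∀ n, n₀ ≤ n → runAvg z n ≠ b) : ∀ᶠ c in 𝓝 b, IsFirstBelow n₀ c z N := by
  have h1 : ∀ᶠ c in 𝓝 b, runAvg z N < c := lt_mem_nhds h.2.1
  have h2 : ∀ᶠ c in 𝓝 b, ∀ n ∈ Finset.Ico n₀ N, c < runAvg z n := by
    refine (Finset.eventually_all _).2 fun n hn => ?_
    rw [Finset.mem_Ico] at hn
    exact gt_mem_nhds (lt_of_le_of_ne (h.2.2 n hn.1 hn.2) (hne n hn.1).symm)
  filter_upwards [h1, h2] with c hc1 hc2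
  exact ⟨h.1, hc1, fun n hn hnN => (hc2 n (Finset.mem_Ico.2 ⟨hn, hnN⟩)).le⟩

lemma ae_forall_runAvg_ne {n₀ : ℕ} (hn₀ : 1 ≤ n₀) (b : ℝ) :
    ∀ᵐ z ∂normalStream 0 1, ∀ n, n₀ ≤ n → runAvg z n ≠ b :=
  ae_all_iff.2 fun n => by
    by_cases h : n₀ ≤ n
    · filter_upwards [ae_runAvg_ne (hn₀.trans h) b] with z hz _ using hz
    · exact Eventually.of_forall fun _ h' => absurd h' h

lemma continuousAt_C {n₀ : ℕ} (hn₀ : 1 ≤ n₀) {b : ℝ} (hb : 0 < b) :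
    ContinuousAt (fun b => C b n₀) b := by
  refine tendsto_lintegral_filter_of_dominated_convergence (crossTime n₀ (b / 2))
    (Eventually.of_forall fun c => measurable_crossTime n₀ c) ?_ (C_ne_top (half_pos hb) n₀) ?_
  · filter_upwards [lt_mem_nhds (half_lt_self hb)] with c hc
    exact Eventually.of_forall fun z => crossTime_antitone n₀ z hc.le
  · filter_upwards [ae_crossTime_ne_top hb n₀, ae_forall_runAvg_ne hn₀ b] with z hz hne
    obtain ⟨N, hN⟩ := exists_isFirstBelow_of_ne_top hz
    refine tendsto_const_nhds.congr' ?_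
    filter_upwards [eventually_isFirstBelow hN hne] with c hc
    rw [hN.crossTime_eq, hc.crossTime_eq]

/-- Fatou's lemma along levels decreasing to 0, where `C` is infinite. -/
lemma exists_lt_C {n₀ : ℕ} (hn₀ : 1 ≤ n₀) {r : ℝ≥0∞} (hr : r < ⊤) : ∃ b, 0 < b ∧ r < C b n₀ := by
  by_contra hcon
  push Not at hcon
  set u : ℕ → ℝ := fun n => 1 / ((n : ℝ) + 1) with hu
  have hu0 : Tendsto u atTop (𝓝 0) := tendsto_one_div_add_atTop_nhds_zero_nat
  have hpos (n : ℕ) : 0 < u n := Nat.one_div_pos_of_nat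
  have hfatou := lintegral_liminf_le (μ := normalStream 0 1) (u := atTop)
    (f := fun n => crossTime n₀ (u n)) (fun n => measurable_crossTime n₀ (u n))
  have hlim : ∀ᵐ z ∂normalStream 0 1,
      liminf (fun n => crossTime n₀ (u n) z) atTop = crossTime n₀ 0 z := by
    filter_upwards [ae_exists_runAvg_neg n₀, ae_forall_runAvg_ne hn₀ 0] with z hz hne
    obtain ⟨N, hN⟩ := exists_isFirstBelow hz
    refine Tendsto.liminf_eq (tendsto_const_nhds.congr' ?_)
    filter_upwards [hu0.eventually (eventually_isFirstBelow hN hne)] with n hn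
    rw [hN.crossTime_eq, hn.crossTime_eq]
  rw [lintegral_congr_ae hlim] at hfatou
  change C 0 n₀ ≤ _ at hfatou
  rw [C_zero hn₀, top_le_iff] at hfatou
  have hle : liminf (fun n => ∫⁻ z, crossTime n₀ (u n) z ∂normalStream 0 1) atTop ≤ r :=
    liminf_le_of_frequently_le' (Frequently.of_forall fun n => hcon (u n) (hpos n))
  rw [hfatou] at hle
  exact absurd hr (not_lt.2 hle)

lemma exists_C_eq {n₀ : ℕ} (hn₀ : 1 ≤ n₀) {b : ℝ} (hb : 0 < b) {r : ℝ≥0∞} (hr : r < ⊤)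
    (hbr : C b n₀ < r) : ∃ c, 0 < c ∧ c < b ∧ C c n₀ = r := by
  obtain ⟨a, ha, har⟩ := exists_lt_C hn₀ hr
  have hab : a ≤ b := by
    by_contra h
    exact absurd (hbr.trans har) (not_lt.2 (C_antitone n₀ (not_le.1 h).le))
  have hcont : ContinuousOn (fun b => C b n₀) (Set.Icc a b) := fun c hc =>
    (continuousAt_C hn₀ (ha.trans_le hc.1)).continuousWithinAt
  obtain ⟨c, hc, hcr⟩ := intermediate_value_Icc' hab hcont ⟨hbr.le, har.le⟩
  refine ⟨c, ha.trans_le hc.1, lt_of_le_of_ne hc.2 ?_, hcr⟩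
  rintro rfl
  exact hbr.ne hcr

/-! ### Pathwise analysis of the greedy procedure -/

section Dynamics

variable {ι : Type*} [DecidableEq ι]

/-- The alternative from which observation `t + 1` after the exploration phase is taken. -/
noncomputable def sampled (a : (ι → ℝ) → ι) (n₀ : ℕ) (x : ι → ℕ → ℝ) (t : ℕ) : ι :=
  a fun i => runAvg (x i) (sampleSize a n₀ x t i)

variable {a : (ι → ℝ) → ι} {n₀ : ℕ} {x : ι → ℕ → ℝ}

lemma sampleSize_succ (t : ℕ) : sampleSize a n₀ x (t + 1) =
    Function.update (sampleSize a n₀ x t) (sampled a n₀ x t)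
      (sampleSize a n₀ x t (sampled a n₀ x t) + 1) := rfl

lemma sampleSize_succ_of_eq {t : ℕ} {i : ι} (h : sampled a n₀ x t = i) :
    sampleSize a n₀ x (t + 1) i = sampleSize a n₀ x t i + 1 := by
  subst h; simp [sampleSize_succ]

lemma sampleSize_succ_of_ne {t : ℕ} {i : ι} (h : sampled a n₀ x t ≠ i) :
    sampleSize a n₀ x (t + 1) i = sampleSize a n₀ x t i := by
  rw [sampleSize_succ, Function.update_of_ne h.symm]

lemma monotone_sampleSize (i : ι) : Monotone fun t => sampleSize a n₀ x t i := by
  refine monotone_nat_of_le_succ fun t => ?_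
  by_cases h : sampled a n₀ x t = i
  · rw [sampleSize_succ_of_eq h]; omega
  · rw [sampleSize_succ_of_ne h]

lemma le_sampleSize (t : ℕ) (i : ι) : n₀ ≤ sampleSize a n₀ x t i :=
  monotone_sampleSize (a := a) (x := x) i (Nat.zero_le t)

lemma sum_sampleSize [Fintype ι] (t : ℕ) :
    ∑ i, sampleSize a n₀ x t i = n₀ * Fintype.card ι + t := by
  induction t with
  | zero => simp [sampleSize, mul_comm]
  | succ t ih =>
    rw [← add_assoc, ← ih,
      ← Finset.sum_erase_add _ (sampleSize a n₀ x (t + 1)) (Finset.mem_univ (sampled a n₀ x t)),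
      sampleSize_succ_of_eq rfl,
      ← Finset.sum_erase_add _ (sampleSize a n₀ x t)
        (Finset.mem_univ (sampled a n₀ x t)), ← add_assoc]
    congr 2
    exact Finset.sum_congr rfl fun i hi =>
      sampleSize_succ_of_ne (Finset.ne_of_mem_erase hi).symm

/-- Sample sizes grow by at most one per step, so none is skipped. -/
lemma exists_sampled_eq {t : ℕ} {i : ι} {n : ℕ} (hn : n₀ ≤ n) (h : n < sampleSize a n₀ x t i) :
    ∃ s < t, sampleSize a n₀ x s i = n ∧ sampled a n₀ x s = i := by
  induction t with
  | zero => simp [sampleSize] at h; omega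
  | succ t ih =>
    by_cases hlt : n < sampleSize a n₀ x t i
    · obtain ⟨s, hs, h'⟩ := ih hlt
      exact ⟨s, by omega, h'⟩
    · by_cases hs : sampled a n₀ x t = i
      · rw [sampleSize_succ_of_eq hs] at h
        exact ⟨t, by omega, by omega, hs⟩
      · rw [sampleSize_succ_of_ne hs] at h
        exact absurd h hlt

/-- An alternative is not sampled once its running average has fallen below a level that another
alternative exceeds. -/
lemma sampleSize_le (ha : ∀ (y : ι → ℝ) (i : ι), y i ≤ y (a y)) {t : ℕ} {c : ℝ}
    (h : ∀ s < t, ∃ l, c ≤ runAvg (x l) (sampleSize a n₀ x s l)) {i : ι} {n : ℕ} (hn : n₀ ≤ n)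
    (hlt : runAvg (x i) n < c) : sampleSize a n₀ x t i ≤ n := by
  by_contra hcon
  obtain ⟨s, hst, hs, hsi⟩ := exists_sampled_eq hn (not_le.1 hcon)
  obtain ⟨l, hl⟩ := h s hst
  have := ha (fun i => runAvg (x i) (sampleSize a n₀ x s i)) l
  change _ ≤ runAvg (x (sampled a n₀ x s)) (sampleSize a n₀ x s (sampled a n₀ x s)) at this
  rw [hsi, hs] at this
  linarith

/-- If the running average of alternative `o` attains its minimum at time `N` and the budget
suffices for the other alternatives to fall below this minimum, then `o` is selected. -/
lemma sampled_eq_of_sum_lt [Fintype ι] (ha : ∀ (y : ι → ℝ) (i : ι), y i ≤ y (a y)) {t : ℕ} {o : ι}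
    {N : ℕ} (hN : n₀ ≤ N) (hmin : ∀ n, n₀ ≤ n → runAvg (x o) N ≤ runAvg (x o) n)
    (htie : ∀ n, N < n → ∀ i ≠ o, ∀ m, n₀ ≤ m → runAvg (x i) m ≤ runAvg (x o) N →
      runAvg (x i) m < runAvg (x o) n)
    {T : ι → ℕ} (hT : ∀ i ≠ o, n₀ ≤ T i ∧ runAvg (x i) (T i) < runAvg (x o) N)
    (hsum : N + ∑ i ∈ Finset.univ.erase o, T i < n₀ * Fintype.card ι + t) :
    sampled a n₀ x t = o := by
  have hle : ∀ i ≠ o, sampleSize a n₀ x t i ≤ T i := fun i hi =>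
    sampleSize_le ha (fun s _ => ⟨o, hmin _ (le_sampleSize s o)⟩) (hT i hi).1 (hT i hi).2
  -- The others hold at most `∑ T i` observations, so the rest of the budget takes `o` beyond `N`.
  have hNo : N < sampleSize a n₀ x t o := by
    rw [← sum_sampleSize (a := a) (x := x), ← Finset.sum_erase_add _ _ (Finset.mem_univ o)] at hsum
    have : ∑ i ∈ Finset.univ.erase o, sampleSize a n₀ x t i ≤ ∑ i ∈ Finset.univ.erase o, T i :=
      Finset.sum_le_sum fun i hi => hle i (Finset.ne_of_mem_erase hi)
    omega
  obtain ⟨s, hst, hs, hso⟩ := exists_sampled_eq hN hNo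
  -- At step `s` the rule picks `o` at its minimum, so no other average exceeds this minimum. By
  -- `htie`, `o` then wins strictly at every later step and the others stay frozen.
  have key : ∀ r, s + 1 ≤ r → N < sampleSize a n₀ x r o ∧
      ∀ i ≠ o, runAvg (x i) (sampleSize a n₀ x r i) ≤ runAvg (x o) N := by
    have hstep : ∀ r, N < sampleSize a n₀ x r o →
        (∀ i ≠ o, runAvg (x i) (sampleSize a n₀ x r i) ≤ runAvg (x o) N) →
        sampled a n₀ x r = o := by
      intro r h1 h2
      by_contra hne
      have h3 := ha (fun i => runAvg (x i) (sampleSize a n₀ x r i)) o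
      have h4 := htie _ h1 _ hne _ (le_sampleSize r _) (h2 _ hne)
      exact absurd h4 (not_lt.2 h3)
    intro r hr
    induction r, hr using Nat.le_induction with
    | base =>
      refine ⟨by rw [sampleSize_succ_of_eq hso]; omega, fun i hi => ?_⟩
      rw [sampleSize_succ_of_ne (by rw [hso]; exact hi.symm)]
      have := ha (fun i => runAvg (x i) (sampleSize a n₀ x s i)) i
      change _ ≤ runAvg (x (sampled a n₀ x s)) (sampleSize a n₀ x s (sampled a n₀ x s)) at this
      rwa [hso, hs] at this
    | succ r _ ih =>
      have hro := hstep r ih.1 ih.2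
      refine ⟨by rw [sampleSize_succ_of_eq hro]; omega, fun i hi => ?_⟩
      rw [sampleSize_succ_of_ne (by rw [hro]; exact hi.symm)]
      exact ih.2 i hi
  obtain ⟨h1, h2⟩ := key t hst
  by_contra hne
  have h3 := ha (fun i => runAvg (x i) (sampleSize a n₀ x t i)) o
  exact absurd (htie _ h1 _ hne _ (le_sampleSize t _) (h2 _ hne)) (not_lt.2 h3)

/-- If alternative `o` falls at time `N` from above `c` to below `b`, and the budget suffices for
the other alternatives to fall below `c` but not for all of them to fall below `b`, then `o` is not
selected. -/
lemma sampled_ne_of_lt_sum [Fintype ι] (ha : ∀ (y : ι → ℝ) (i : ι), y i ≤ y (a y)) {t : ℕ} {o : ι}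
    {N : ℕ} {b c : ℝ} (hN : n₀ ≤ N) (hNb : runAvg (x o) N < b)
    (hNc : ∀ n, n₀ ≤ n → n < N → c ≤ runAvg (x o) n)
    {T U : ι → ℕ} (hT : ∀ i ≠ o, n₀ ≤ T i ∧ runAvg (x i) (T i) < c)
    (hU : ∀ i ≠ o, ∀ n, n₀ ≤ n → n < U i → b ≤ runAvg (x i) n)
    (hTsum : N + ∑ i ∈ Finset.univ.erase o, T i ≤ n₀ * Fintype.card ι + t)
    (hUsum : n₀ * Fintype.card ι + t < ∑ i ∈ Finset.univ.erase o, U i) :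
    sampled a n₀ x t ≠ o := by
  -- Before its `N`-th observation `o` stays at or above `c`, which holds the others to at most `T
  -- i` observations.
  have hNo : N ≤ sampleSize a n₀ x t o := by
    by_contra hlt
    have hle : ∀ i ≠ o, sampleSize a n₀ x t i ≤ T i := fun i hi =>
      sampleSize_le ha (fun s hs => ⟨o, hNc _ (le_sampleSize s o)
        ((monotone_sampleSize o hs.le).trans_lt (not_le.1 hlt))⟩) (hT i hi).1 (hT i hi).2
    rw [← sum_sampleSize (a := a) (x := x), ← Finset.sum_erase_add _ _ (Finset.mem_univ o)] at hTsum
    have : ∑ i ∈ Finset.univ.erase o, sampleSize a n₀ x t i ≤ ∑ i ∈ Finset.univ.erase o, T i :=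
      Finset.sum_le_sum fun i hi => hle i (Finset.ne_of_mem_erase hi)
    omega
  -- Bringing every competitor below `b` would take more observations than are available.
  have hmax : ∀ s ≤ t, ∃ l, b ≤ runAvg (x l) (sampleSize a n₀ x s l) := by
    intro s hs
    by_contra hcon
    push Not at hcon
    have hge : ∀ i ≠ o, U i ≤ sampleSize a n₀ x s i := by
      intro i hi
      by_contra hlt
      exact absurd (hU i hi _ (le_sampleSize s i) (not_le.1 hlt)) (not_le.2 (hcon i))
    have h1 : ∑ i ∈ Finset.univ.erase o, U i ≤
        ∑ i ∈ Finset.univ.erase o, sampleSize a n₀ x s i :=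
      Finset.sum_le_sum fun i hi => hge i (Finset.ne_of_mem_erase hi)
    have h2 := sum_sampleSize (a := a) (n₀ := n₀) (x := x) s
    rw [← Finset.sum_erase_add _ _ (Finset.mem_univ o)] at h2
    omega
  have heq : sampleSize a n₀ x t o = N :=
    le_antisymm (sampleSize_le ha (fun s hs => hmax s hs.le) hN hNb) hNo
  intro hsel
  obtain ⟨l, hl⟩ := hmax t le_rfl
  have := ha (fun i => runAvg (x i) (sampleSize a n₀ x t i)) l
  change _ ≤ runAvg (x (sampled a n₀ x t)) (sampleSize a n₀ x t (sampled a n₀ x t)) at this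
  rw [hsel, heq] at this
  linarith

end Dynamics

/-! ### Measurability and coupling of all rows on one space -/

lemma measurable_runAvg_comp {α : Type*} [MeasurableSpace α] {f : α → ℕ → ℝ} {N : α → ℕ}
    (hf : Measurable f) (hN : Measurable N) : Measurable fun x => runAvg (f x) (N x) := by
  have h : Measurable fun p : α × ℕ => runAvg (f p.1) p.2 :=
    measurable_from_prod_countable_left fun n => (measurable_runAvg n).comp hf
  exact h.comp (measurable_id.prodMk hN)

lemma measurable_sampled {ι : Type*} [Fintype ι] [DecidableEq ι] [MeasurableSpace ι]
    [DiscreteMeasurableSpace ι] {a : (ι → ℝ) → ι} (ha : Measurable a) (n₀ t : ℕ) :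
    Measurable (fun x => sampled a n₀ x t) ∧ ∀ i, Measurable fun x => sampleSize a n₀ x t i := by
  have hs (t : ℕ) (h : ∀ i, Measurable fun x => sampleSize a n₀ x t i) :
      Measurable fun x => sampled a n₀ x t :=
    ha.comp (measurable_pi_lambda _ fun i => measurable_runAvg_comp (measurable_pi_apply i) (h i))
  suffices h : ∀ i, Measurable fun x => sampleSize a n₀ x t i from ⟨hs t h, h⟩
  induction t with
  | zero => exact fun i => measurable_const
  | succ t ih =>
    intro i
    have he : (fun x => sampleSize a n₀ x (t + 1) i) = fun x =>
        if sampled a n₀ x t = i then sampleSize a n₀ x t i + 1 else sampleSize a n₀ x t i := by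
      ext x
      split_ifs with h
      · exact sampleSize_succ_of_eq h
      · exact sampleSize_succ_of_ne h
    rw [he]
    exact Measurable.ite (hs t ih (measurableSet_singleton i)) ((ih i).add_const 1) (ih i)

/-- The joint law of countably many independent sequences of independent standard normal
observations. -/
noncomputable def stdLaw : Measure (ℕ → ℕ → ℝ) :=
  Measure.infinitePi fun _ : ℕ => normalStream 0 1

instance isProbabilityMeasure_stdLaw : IsProbabilityMeasure stdLaw := by
  unfold stdLaw; infer_instance

/-- The sequence with mean `m` and variance `v` obtained from a standardized sequence. -/
noncomputable def scale (m : ℝ) (v : ℝ≥0) (z : ℕ → ℝ) : ℕ → ℝ := fun j => m + √(v : ℝ) * z j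

lemma measurable_scale (m : ℝ) (v : ℝ≥0) : Measurable (scale m v) :=
  measurable_pi_lambda _ fun j => by unfold scale; fun_prop

lemma map_scale (m : ℝ) (v : ℝ≥0) :
    (normalStream 0 1).map (scale m v) = normalStream m v := by
  have h := Measure.infinitePi_map_pi (μ := fun _ : ℕ => gaussianReal 0 1)
    (f := fun (_ : ℕ) (y : ℝ) => m + √(v : ℝ) * y) (fun _ => by fun_prop)
  have hg : (gaussianReal 0 1).map (fun y : ℝ => m + √(v : ℝ) * y) = gaussianReal m v := by
    have hc : (fun y : ℝ => m + √(v : ℝ) * y) = (fun y => m + y) ∘ fun y => √(v : ℝ) * y := rfl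
    rw [hc, ← Measure.map_map (by fun_prop) (by fun_prop), gaussianReal_map_const_mul,
      gaussianReal_map_const_add]
    congr 1
    · simp
    · ext; simp
  simp only [hg] at h
  exact h

lemma runAvg_scale (m : ℝ) (v : ℝ≥0) (z : ℕ → ℝ) {n : ℕ} (hn : 1 ≤ n) :
    runAvg (scale m v z) n = m + √(v : ℝ) * runAvg z n := by
  have h0 : (n : ℝ) ≠ 0 := by exact_mod_cast (by omega : n ≠ 0)
  simp only [runAvg, scale, Finset.sum_add_distrib, ← Finset.mul_sum, Finset.sum_const,
    Finset.card_range, nsmul_eq_mul]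
  field_simp

lemma measurable_scale_pi {k : ℕ} (μ : Fin (k + 1) → ℝ) (v : Fin (k + 1) → ℝ≥0) :
    Measurable fun (ω : ℕ → ℕ → ℝ) (i : Fin (k + 1)) => scale (μ i) (v i) (ω i) :=
  measurable_pi_lambda _ fun _ => (measurable_scale _ _).comp (measurable_pi_apply _)

/-- Every row is a scaling of the same standard sequences. Probabilities of correct selection depend
only on the law, so the coupling is harmless and allows almost sure limits in `k`. -/
lemma map_stdLaw {k : ℕ} (μ : Fin (k + 1) → ℝ) (v : Fin (k + 1) → ℝ≥0) :
    stdLaw.map (fun (ω : ℕ → ℕ → ℝ) (i : Fin (k + 1)) => scale (μ i) (v i) (ω i)) =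
      obsLaw μ v := by
  have h1 := Measure.map_infinitePi_infinitePi_of_inj (P := fun _ : ℕ => normalStream 0 1)
    (Fin.val_injective (n := k + 1))
  have h2 := Measure.infinitePi_map_pi (μ := fun _ : Fin (k + 1) => normalStream 0 1)
    (f := fun i => scale (μ i) (v i)) (fun i => measurable_scale _ _)
  simp only [map_scale] at h2
  rw [obsLaw, ← Measure.infinitePi_eq_pi, ← h2, ← h1, Measure.map_map]
  · rfl
  · exact measurable_pi_lambda _ fun i => (measurable_scale _ _).comp (measurable_pi_apply _)
  · fun_prop

lemma map_eval_stdLaw (i : ℕ) : stdLaw.map (fun ω => ω i) = normalStream 0 1 :=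
  Measure.infinitePi_map_eval (fun _ : ℕ => normalStream 0 1) i

lemma ae_stdLaw_eval {p : (ℕ → ℝ) → Prop} (h : ∀ᵐ z ∂normalStream 0 1, p z) :
    ∀ᵐ ω ∂stdLaw, ∀ i, p (ω i) := by
  refine ae_all_iff.2 fun i => ?_
  rw [← map_eval_stdLaw i] at h
  exact ae_of_ae_map (measurable_pi_apply i).aemeasurable h

/-- The event that the greedy procedure selects alternative `0`. -/
def selectZero {k : ℕ} (μ : Fin (k + 1) → ℝ) (v : Fin (k + 1) → ℝ≥0)
    (a : (Fin (k + 1) → ℝ) → Fin (k + 1)) (n₀ B : ℕ) : Set (ℕ → ℕ → ℝ) :=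
  {ω | selected a n₀ B (fun i => scale (μ i) (v i) (ω i)) = 0}

lemma measurableSet_selected {k : ℕ} {a : (Fin (k + 1) → ℝ) → Fin (k + 1)} (ha : Measurable a)
    (n₀ B : ℕ) : MeasurableSet {x | selected a n₀ B x = 0} :=
  (measurable_sampled ha n₀ _).1 (measurableSet_singleton 0)

lemma measurableSet_selectZero {k : ℕ} (μ : Fin (k + 1) → ℝ) (v : Fin (k + 1) → ℝ≥0)
    {a : (Fin (k + 1) → ℝ) → Fin (k + 1)} (ha : Measurable a) (n₀ B : ℕ) :
    MeasurableSet (selectZero μ v a n₀ B) :=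
  measurable_scale_pi μ v (measurableSet_selected ha n₀ B)

lemma PCS_eq {k : ℕ} (μ : Fin (k + 1) → ℝ) (v : Fin (k + 1) → ℝ≥0)
    {a : (Fin (k + 1) → ℝ) → Fin (k + 1)} (ha : Measurable a) (n₀ B : ℕ) :
    PCS μ v a n₀ B = stdLaw (selectZero μ v a n₀ B) := by
  rw [PCS, ← map_stdLaw, Measure.map_apply (measurable_scale_pi μ v) (measurableSet_selected ha _ _)]
  rfl

/-- The event that all running averages of the first alternative exceed `b` from time `n₀` on. -/
def minGT (m : ℝ) (v : ℝ≥0) (n₀ : ℕ) (b : ℝ) : Set (ℕ → ℕ → ℝ) :=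
  {ω | (b : EReal) < ⨅ (n : ℕ) (_ : n₀ ≤ n), ((runAvg (scale m v (ω 0)) n : ℝ) : EReal)}

lemma measurableSet_lt_iInf_runAvg (n₀ : ℕ) (b : ℝ) : MeasurableSet
    {x : ℕ → ℝ | (b : EReal) < ⨅ (n : ℕ) (_ : n₀ ≤ n), ((runAvg x n : ℝ) : EReal)} :=
  measurableSet_lt measurable_const <| .iInf fun n => .iInf fun _ =>
    measurable_coe_real_ereal.comp (measurable_runAvg n)

lemma measurableSet_minGT (m : ℝ) (v : ℝ≥0) (n₀ : ℕ) (b : ℝ) :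
    MeasurableSet (minGT m v n₀ b) :=
  ((measurable_scale m v).comp (measurable_pi_apply 0)) (measurableSet_lt_iInf_runAvg n₀ b)

lemma probMinGT_eq (m : ℝ) (v : ℝ≥0) (n₀ : ℕ) (b : ℝ) :
    probMinGT m v n₀ b = stdLaw (minGT m v n₀ b) := by
  rw [probMinGT, ← map_scale, ← map_eval_stdLaw 0, Measure.map_map (measurable_scale m v)
    (measurable_pi_apply 0), Measure.map_apply ((measurable_scale m v).comp (measurable_pi_apply 0))
    (measurableSet_lt_iInf_runAvg n₀ b)]
  rfl

lemma lt_runAvg_of_mem_minGT {m : ℝ} {v : ℝ≥0} {n₀ : ℕ} {b : ℝ} {ω : ℕ → ℕ → ℝ}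
    (h : ω ∈ minGT m v n₀ b) {n : ℕ} (hn : n₀ ≤ n) : b < runAvg (scale m v (ω 0)) n :=
  EReal.coe_lt_coe_iff.1 (lt_of_lt_of_le h (iInf₂_le (f := fun (n : ℕ) (_ : n₀ ≤ n) =>
    ((runAvg (scale m v (ω 0)) n : ℝ) : EReal)) n hn))

lemma mem_minGT_of_min {m : ℝ} {v : ℝ≥0} {n₀ : ℕ} {b : ℝ} {ω : ℕ → ℕ → ℝ} {N : ℕ}
    (hmin : ∀ n, n₀ ≤ n → runAvg (scale m v (ω 0)) N ≤ runAvg (scale m v (ω 0)) n)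
    (h : b < runAvg (scale m v (ω 0)) N) : ω ∈ minGT m v n₀ b :=
  lt_of_lt_of_le (EReal.coe_lt_coe_iff.2 h)
    (le_iInf₂ fun n hn => EReal.coe_le_coe_iff.2 (hmin n hn))

lemma ae_tendsto_avg_crossTime {b : ℝ} (hb : 0 < b) (n₀ : ℕ) :
    ∀ᵐ ω ∂stdLaw, Tendsto
      (fun k : ℕ => (∑ i ∈ Finset.range k, (crossTime n₀ b (ω (i + 1))).toReal) / k) atTop
      (𝓝 (C b n₀).toReal) := by
  set τ : (ℕ → ℝ) → ℝ := fun z => (crossTime n₀ b z).toReal with hτ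
  have hτm : Measurable τ := (measurable_crossTime n₀ b).ennreal_toReal
  have hτi : Integrable τ (normalStream 0 1) :=
    integrable_toReal_of_lintegral_ne_top (measurable_crossTime n₀ b).aemeasurable
      (C_ne_top hb n₀)
  have hτC : ∫ z, τ z ∂normalStream 0 1 = (C b n₀).toReal :=
    integral_toReal (measurable_crossTime n₀ b).aemeasurable
      (ae_lt_top (measurable_crossTime n₀ b) (C_ne_top hb n₀))
  have hcomp (i : ℕ) : Measurable fun ω : ℕ → ℕ → ℝ => τ (ω i) := hτm.comp (measurable_pi_apply i)
  have hind : iIndepFun (fun (i : ℕ) (ω : ℕ → ℕ → ℝ) => τ (ω i)) stdLaw :=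
    iIndepFun_infinitePi (X := fun _ => τ) fun _ => hτm
  have hmap (i : ℕ) : stdLaw.map (fun ω : ℕ → ℕ → ℝ => τ (ω i)) = (normalStream 0 1).map τ := by
    rw [← map_eval_stdLaw i, Measure.map_map hτm (measurable_pi_apply i)]; rfl
  have h := strong_law_ae_real (μ := stdLaw) (fun (i : ℕ) (ω : ℕ → ℕ → ℝ) => τ (ω (i + 1)))
    (by
      rw [← map_eval_stdLaw 1] at hτi
      exact hτi.comp_measurable (measurable_pi_apply 1))
    (fun i j hij => hind.indepFun (by simpa using hij))
    (fun i => ⟨(hcomp _).aemeasurable, (hcomp _).aemeasurable, by rw [hmap, hmap]⟩)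
  have hint : ∫ ω, τ (ω (0 + 1)) ∂stdLaw = (C b n₀).toReal := by
    rw [← hτC, ← map_eval_stdLaw 1, integral_map (measurable_pi_apply 1).aemeasurable
      hτm.aestronglyMeasurable]
  rw [hint] at h
  exact h

lemma sum_erase_zero {k : ℕ} (g : ℕ → ℕ) :
    ∑ i ∈ Finset.univ.erase (0 : Fin (k + 1)), g i = ∑ i ∈ Finset.range k, g (i + 1) := by
  have h1 := Finset.sum_erase_add Finset.univ (fun i : Fin (k + 1) => g i) (Finset.mem_univ 0)
  have h2 := Fin.sum_univ_eq_sum_range g (k + 1)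
  rw [Finset.sum_range_succ'] at h2
  simp only [Fin.val_zero] at h1
  omega

/-- The constant `D` absorbs the observations of alternative 1 and the rounding of the budget; row
`k` has `k + 1` alternatives but `k` competitors. -/
lemma eventually_add_lt_of_tendsto {S : ℕ → ℝ} {s r : ℝ}
    (hS : Tendsto (fun k : ℕ => S k / k) atTop (𝓝 s)) (hsr : s < r) (D : ℝ) :
    ∀ᶠ k : ℕ in atTop, S k + D < r * (k + 1 : ℕ) := by
  have h := hS.add (tendsto_const_div_atTop_nhds_zero_nat (D - r))
  rw [add_zero] at h
  filter_upwards [h.eventually (gt_mem_nhds hsr), eventually_ge_atTop 1] with k hk hk1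
  have h0 : (0 : ℝ) < k := by exact_mod_cast hk1
  rw [← add_div, div_lt_iff₀ h0] at hk
  push_cast
  linarith

lemma eventually_lt_of_tendsto {S : ℕ → ℝ} {s r : ℝ}
    (hS : Tendsto (fun k : ℕ => S k / k) atTop (𝓝 s)) (hrs : r < s) (D : ℝ) :
    ∀ᶠ k : ℕ in atTop, r * (k + 1 : ℕ) + D < S k := by
  have h := eventually_add_lt_of_tendsto (S := fun k => -S k) (s := -s) (r := -r)
    (by simpa only [neg_div] using hS.neg) (by linarith) D
  filter_upwards [h] with k hk
  linarith

/-- A value below the limit confines the minimizers to a finite range. Choosing the last one makes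
all later values strictly larger, which rules out harmful ties. -/
lemma exists_last_argmin {u : ℕ → ℝ} {L : ℝ} (hu : Tendsto u atTop (𝓝 L)) {n₀ : ℕ}
    (h : ∃ n, n₀ ≤ n ∧ u n < L) :
    ∃ N, n₀ ≤ N ∧ (∀ n, n₀ ≤ n → u N ≤ u n) ∧ ∀ n, N < n → u N < u n := by
  obtain ⟨n₁, hn₁, hL⟩ := h
  obtain ⟨M, hM⟩ := eventually_atTop.1 (hu.eventually (lt_mem_nhds hL))
  have hn₁M : n₁ < M := by
    by_contra hlt
    exact lt_irrefl _ (hM n₁ (not_lt.1 hlt))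
  obtain ⟨p, hp, hpmin⟩ := (Finset.Ico n₀ M).exists_min_image u
    ⟨n₁, Finset.mem_Ico.2 ⟨hn₁, hn₁M⟩⟩
  have hall : ∀ n, n₀ ≤ n → u p ≤ u n := by
    intro n hn
    by_cases hnM : n < M
    · exact hpmin n (Finset.mem_Ico.2 ⟨hn, hnM⟩)
    · exact (hpmin n₁ (Finset.mem_Ico.2 ⟨hn₁, hn₁M⟩)).trans (hM n (not_lt.1 hnM)).le
  obtain ⟨N, hN, hNmax⟩ := ((Finset.Ico n₀ M).filter fun n => u n ≤ u p).exists_max_image id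
    ⟨p, Finset.mem_filter.2 ⟨hp, le_rfl⟩⟩
  rw [Finset.mem_filter, Finset.mem_Ico] at hN
  refine ⟨N, hN.1.1, fun n hn => hN.2.trans (hall n hn), fun n hn => ?_⟩
  by_contra hcon
  have hnp : u n ≤ u p := (not_lt.1 hcon).trans hN.2
  have hnM : n < M := by
    by_contra hlt
    have h1 := hM n (not_lt.1 hlt)
    have h2 := hall n₁ hn₁
    linarith
  have := hNmax n (Finset.mem_filter.2 ⟨Finset.mem_Ico.2 ⟨by omega, hnM⟩, hnp⟩)
  simp only [id] at this
  omega

/-- Almost surely the minimum of the running averages of alternative `0` is attained, and later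
running averages are not tied with those of the other alternatives below the minimum. -/
lemma ae_exists_argmin (μ : ∀ k : ℕ, Fin (k + 1) → ℝ) (v : ∀ k : ℕ, Fin (k + 1) → ℝ≥0)
    (μ₁ : ℝ) (v₁ : ℝ≥0) {γ : ℝ} (hγ : 0 < γ) (hgap : ∀ k i, i ≠ 0 → γ ≤ μ₁ - μ k i)
    {n₀ : ℕ} (hn₀ : 1 ≤ n₀) :
    ∀ᵐ ω ∂stdLaw, ∃ N, n₀ ≤ N ∧
      (∀ n, n₀ ≤ n → runAvg (scale μ₁ v₁ (ω 0)) N ≤ runAvg (scale μ₁ v₁ (ω 0)) n) ∧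
      ∀ n, N < n → ∀ k, ∀ i : Fin (k + 1), i ≠ 0 → ∀ m, n₀ ≤ m →
        runAvg (scale (μ k i) (v k i) (ω i)) m ≤ runAvg (scale μ₁ v₁ (ω 0)) N →
        runAvg (scale (μ k i) (v k i) (ω i)) m < runAvg (scale μ₁ v₁ (ω 0)) n := by
  -- With zero variance the averages are constant and there is no last minimizer. Instead,
  -- competitors almost surely never equal `μ₁`: either they are random with no atom there, or
  -- constant and lower by `γ`.
  by_cases hv : v₁ = 0
  · subst hv
    have hconst (ω : ℕ → ℕ → ℝ) (n : ℕ) (hn : n₀ ≤ n) :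
        runAvg (scale μ₁ 0 (ω 0)) n = μ₁ := by
      rw [runAvg_scale _ _ _ (hn₀.trans hn)]; simp
    have hne : ∀ᵐ ω ∂stdLaw, ∀ k, ∀ i : Fin (k + 1), ∀ m, n₀ ≤ m →
        runAvg (ω i) m ≠ (μ₁ - μ k i) / √(v k i : ℝ) := by
      refine ae_all_iff.2 fun k => ae_all_iff.2 fun i => ?_
      filter_upwards [ae_stdLaw_eval (ae_forall_runAvg_ne hn₀ ((μ₁ - μ k i) / √(v k i : ℝ)))]
        with ω hω using hω i
    filter_upwards [hne] with ω hω
    refine ⟨n₀, le_rfl, fun n hn => by rw [hconst ω n hn, hconst ω n₀ le_rfl], ?_⟩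
    intro n hn k i hi m hm hle
    rw [hconst ω n hn.le]
    rw [hconst ω n₀ le_rfl] at hle
    refine lt_of_le_of_ne hle ?_
    rw [runAvg_scale _ _ _ (hn₀.trans hm)]
    intro heq
    by_cases hs : √(v k i : ℝ) = 0
    · have := hgap k i hi
      rw [hs] at heq
      linarith
    · refine hω k i m hm ?_
      rw [eq_div_iff hs]
      linarith
  · have hs : 0 < √(v₁ : ℝ) := Real.sqrt_pos.2 (NNReal.coe_pos.2 (pos_iff_ne_zero.2 hv))
    filter_upwards [ae_stdLaw_eval ae_tendsto_runAvg, ae_stdLaw_eval (ae_exists_runAvg_neg n₀)]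
      with ω hlim hneg
    have hu : Tendsto (fun n => runAvg (scale μ₁ v₁ (ω 0)) n) atTop (𝓝 μ₁) := by
      have h := ((hlim 0).const_mul √(v₁ : ℝ)).const_add μ₁
      rw [mul_zero, add_zero] at h
      refine h.congr' ?_
      filter_upwards [eventually_ge_atTop 1] with n hn
      rw [runAvg_scale _ _ _ hn]
    obtain ⟨n, hn, hlt⟩ := hneg 0
    obtain ⟨N, h1, h2, h3⟩ := exists_last_argmin hu (n₀ := n₀) ⟨n, hn, by
      rw [runAvg_scale _ _ _ (hn₀.trans hn)]
      have := mul_neg_of_pos_of_neg hs hlt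
      linarith⟩
    exact ⟨N, h1, h2, fun n hn _ _ _ _ _ hle => hle.trans_lt (h3 n hn)⟩

/-- Almost surely, for all rational levels the crossing times of the alternatives other than `0`
are finite and satisfy the law of large numbers. -/
lemma ae_exists_crossTimes (n₀ : ℕ) :
    ∀ᵐ ω ∂stdLaw, ∀ q : ℚ, 0 < (q : ℝ) → ∃ T : ℕ → ℕ, (∀ i, IsFirstBelow n₀ q (ω i) (T i)) ∧
      Tendsto (fun k : ℕ => ((∑ i ∈ Finset.univ.erase (0 : Fin (k + 1)), T i : ℕ) : ℝ) / k) atTop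
        (𝓝 (C q n₀).toReal) := by
  refine ae_all_iff.2 fun q => ?_
  by_cases hq : 0 < (q : ℝ)
  · filter_upwards [ae_tendsto_avg_crossTime hq n₀, ae_stdLaw_eval (ae_crossTime_ne_top hq n₀)]
      with ω hlim hfin _
    choose T hT using fun i => exists_isFirstBelow_of_ne_top (hfin i)
    refine ⟨T, hT, ?_⟩
    simpa only [sum_erase_zero, Nat.cast_sum, (hT _).crossTime_eq, ENNReal.toReal_natCast]
      using hlim
  · exact Eventually.of_forall fun _ h => absurd h hq

/-- At a positive level, a smaller variance only makes falling below easier. -/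
lemma scale_lt {m s σbar c z : ℝ} (hs : 0 ≤ s) (hsσ : s ≤ σbar) (hc : 0 < c) (hσ : 0 < σbar)
    (hz : z < c) : m + s * z < m + σbar * c := by
  have : s * z < σbar * c := by
    rcases le_or_gt z 0 with h | h
    · exact (mul_nonpos_of_nonneg_of_nonpos hs h).trans_lt (mul_pos hσ hc)
    · exact (mul_le_mul_of_nonneg_right hsσ h.le).trans_lt (mul_lt_mul_of_pos_left hz hσ)
  linarith

/-! ### Almost sure outcome for large `k` -/

section Limit

variable {μ : ∀ k : ℕ, Fin (k + 1) → ℝ} {v : ∀ k : ℕ, Fin (k + 1) → ℝ≥0} {μ₁ : ℝ} {v₁ : ℝ≥0}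
  {γ σbar : ℝ} {a : ∀ k : ℕ, (Fin (k + 1) → ℝ) → Fin (k + 1)} {n₀ : ℕ} {r : ℝ} {B : ℕ → ℕ} {γ₀ : ℝ}

lemma ae_eventually_mem_selectZero (hμ₁ : ∀ k, μ k 0 = μ₁) (hv₁ : ∀ k, v k 0 = v₁)
    (hγ : 0 < γ) (hσbar : 0 < σbar) (hgap : ∀ k i, i ≠ 0 → γ ≤ μ₁ - μ k i)
    (hvar : ∀ k i, (v k i : ℝ) ≤ σbar ^ 2) (ha : ∀ k, IsArgmaxRule (a k)) (hn₀ : 1 ≤ n₀)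
    (hB : ∀ k, |(B k : ℝ) - r * ((k + 1 : ℕ) : ℝ)| < 1) (hγ₀ : γ₀ < γ)
    (hC : C ((γ - γ₀) / σbar) n₀ = ENNReal.ofReal r) :
    ∀ᵐ ω ∂stdLaw, ω ∈ minGT μ₁ v₁ n₀ (μ₁ - γ₀) →
      ∀ᶠ k in atTop, ω ∈ selectZero (μ k) (v k) (a k) n₀ (B k) := by
  filter_upwards [ae_exists_argmin μ v μ₁ v₁ hγ hgap hn₀, ae_exists_crossTimes n₀]
    with ω ⟨N, hN, hmin, htie⟩ hcross hω
  have hlt := lt_runAvg_of_mem_minGT hω hN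
  set M := runAvg (scale μ₁ v₁ (ω 0)) N
  have hβ0 : 0 < (γ - γ₀) / σbar := div_pos (by linarith) hσbar
  -- The level depends on the sample path through `M`. Taking it rational keeps the union of
  -- exceptional null sets countable.
  obtain ⟨q, hq1, hq2⟩ := exists_rat_btwn
    (show (γ - γ₀) / σbar < (M - μ₁ + γ) / σbar from
      (div_lt_div_iff_of_pos_right hσbar).2 (by linarith))
  have hq0 : (0 : ℝ) < q := hβ0.trans hq1
  rw [lt_div_iff₀ hσbar, mul_comm] at hq2
  obtain ⟨T, hT, hlim⟩ := hcross q hq0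
  have hCq : (C q n₀).toReal < r := by
    have h := C_strictAnti hn₀ hq0 hq1
    rw [hC] at h
    exact (ENNReal.lt_ofReal_iff_toReal_lt h.ne_top).1 h
  filter_upwards [eventually_add_lt_of_tendsto hlim hCq (N + 1)] with k hk
  have hBk := (abs_lt.1 (hB k)).1
  have hsum : N + ∑ i ∈ Finset.univ.erase (0 : Fin (k + 1)), T i < B k := by
    have : ((N + ∑ i ∈ Finset.univ.erase (0 : Fin (k + 1)), T i : ℕ) : ℝ) < B k := by
      push_cast at hk hBk ⊢
      linarith
    exact_mod_cast this
  -- The final selection uses the same argmax as sampling, so it is the alternative that would be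
  -- sampled next.
  change sampled (a k) n₀ _ (B k - n₀ * Fintype.card (Fin (k + 1))) = 0
  refine sampled_eq_of_sum_lt (N := N) (T := fun i => T i) (ha k).2 hN ?_ ?_ ?_ (by omega)
  · simpa only [hμ₁, hv₁, Fin.val_zero] using hmin
  · simp only [hμ₁, hv₁, Fin.val_zero]
    exact fun n hn i hi m hm => htie n hn k i hi m hm
  · simp only [hμ₁, hv₁, Fin.val_zero]
    intro i hi
    refine ⟨(hT i).1, ?_⟩
    rw [runAvg_scale _ _ _ (hn₀.trans (hT i).1)]
    refine (scale_lt (Real.sqrt_nonneg _) (Real.sqrt_le_iff.2 ⟨hσbar.le, hvar k i⟩) hq0 hσbar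
      (hT i).2.1).trans ?_
    have := hgap k i hi
    change _ < M
    linarith

lemma ae_eventually_notMem_selectZero (hμ₁ : ∀ k, μ k 0 = μ₁) (hv₁ : ∀ k, v k 0 = v₁)
    (hγ : 0 < γ) (hσbar : 0 < σbar) (hgap : ∀ k i, i ≠ 0 → μ k i = μ₁ - γ)
    (hvar : ∀ k i, (v k i : ℝ) = σbar ^ 2) (ha : ∀ k, IsArgmaxRule (a k)) (hn₀ : 1 ≤ n₀)
    (hB : ∀ k, |(B k : ℝ) - r * ((k + 1 : ℕ) : ℝ)| < 1) (hγ₀ : γ₀ < γ)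
    (hC : C ((γ - γ₀) / σbar) n₀ = ENNReal.ofReal r) (hr : 0 < r) :
    ∀ᵐ ω ∂stdLaw, ω ∉ minGT μ₁ v₁ n₀ (μ₁ - γ₀) →
      ∀ᶠ k in atTop, ω ∉ selectZero (μ k) (v k) (a k) n₀ (B k) := by
  have hsqrt : ∀ k i, √(v k i : ℝ) = σbar := fun k i => by
    rw [hvar, Real.sqrt_sq hσbar.le]
  have hsqrt₁ : √(v₁ : ℝ) = σbar := by rw [← hv₁ 0, hsqrt]
  have hβ0 : 0 < (γ - γ₀) / σbar := div_pos (by linarith) hσbar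
  filter_upwards [ae_exists_argmin μ v μ₁ v₁ hγ (fun k i hi => by rw [hgap k i hi]; linarith) hn₀,
    ae_exists_crossTimes n₀, ae_stdLaw_eval (ae_forall_runAvg_ne hn₀ (-γ₀ / σbar))]
    with ω ⟨N', hN', hmin, _⟩ hcross hne hω
  have hbelow : ∃ n, n₀ ≤ n ∧ runAvg (ω 0) n < -γ₀ / σbar := by
    refine ⟨N', hN', lt_of_le_of_ne ?_ (hne 0 N' hN')⟩
    by_contra hcon
    refine hω (mem_minGT_of_min hmin ?_)
    rw [runAvg_scale _ _ _ (hn₀.trans hN'), hsqrt₁]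
    rw [not_le, div_lt_iff₀ hσbar] at hcon
    linarith
  obtain ⟨N, hN⟩ := exists_isFirstBelow hbelow
  -- Levels are standardized for the competitors; subtracting `γ / σbar` converts them for
  -- alternative 1. All nearby levels share the same first crossing time `N`.
  have hnear : ∀ᶠ c in 𝓝 ((γ - γ₀) / σbar), IsFirstBelow n₀ (c - γ / σbar) (ω 0) N := by
    have hcont : Tendsto (fun c : ℝ => c - γ / σbar) (𝓝 ((γ - γ₀) / σbar)) (𝓝 (-γ₀ / σbar)) := by
      have h : Continuous fun c : ℝ => c - γ / σbar := by fun_prop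
      convert! h.tendsto ((γ - γ₀) / σbar) using 2
      ring
    exact hcont.eventually (eventually_isFirstBelow hN (hne 0))
  obtain ⟨l, u, ⟨hl, hu⟩, hlu⟩ := (mem_nhds_iff_exists_Ioo_subset).1 hnear
  -- The maximum with 0 keeps `q` positive. The budget suffices for level `p` but not for level `q`.
  obtain ⟨q, hq1, hq2⟩ := exists_rat_btwn (max_lt hl hβ0)
  obtain ⟨p, hp1, hp2⟩ := exists_rat_btwn hu
  have hq0 : (0 : ℝ) < q := (le_max_right _ _).trans_lt hq1
  have hp0 : (0 : ℝ) < p := hβ0.trans hp1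
  have hqN : IsFirstBelow n₀ (q - γ / σbar) (ω 0) N :=
    hlu ⟨(le_max_left _ _).trans_lt hq1, hq2.trans hu⟩
  have hpN : IsFirstBelow n₀ (p - γ / σbar) (ω 0) N := hlu ⟨hl.trans hp1, hp2⟩
  obtain ⟨T, hT, hTlim⟩ := hcross p hp0
  obtain ⟨U, hU, hUlim⟩ := hcross q hq0
  have hCp : (C p n₀).toReal < r := by
    have h := C_strictAnti hn₀ hp0 hp1
    rw [hC] at h
    exact (ENNReal.lt_ofReal_iff_toReal_lt h.ne_top).1 h
  have hCq : r < (C q n₀).toReal := by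
    have h := C_strictAnti hn₀ hβ0 hq2
    rw [hC] at h
    exact (ENNReal.ofReal_lt_iff_lt_toReal hr.le (C_ne_top hq0 n₀)).1 h
  have hn₀r : (n₀ : ℝ) ≤ r := by
    have h := natCast_le_C ((γ - γ₀) / σbar) n₀
    rw [hC, ← ENNReal.ofReal_natCast] at h
    exact (ENNReal.ofReal_le_ofReal_iff hr.le).1 h
  have hlevel (c : ℝ) : μ₁ + σbar * (c - γ / σbar) = μ₁ - γ + σbar * c := by
    field_simp; ring
  filter_upwards [eventually_add_lt_of_tendsto hTlim hCp (N + 1),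
    eventually_lt_of_tendsto hUlim hCq 1] with k hkT hkU
  obtain ⟨hBk1, hBk2⟩ := abs_lt.1 (hB k)
  have hTsum : N + ∑ i ∈ Finset.univ.erase (0 : Fin (k + 1)), T i < B k := by
    have : ((N + ∑ i ∈ Finset.univ.erase (0 : Fin (k + 1)), T i : ℕ) : ℝ) < B k := by
      push_cast at hkT hBk1 ⊢
      linarith
    exact_mod_cast this
  have hUsum : B k < ∑ i ∈ Finset.univ.erase (0 : Fin (k + 1)), U i := by
    have : (B k : ℝ) < ((∑ i ∈ Finset.univ.erase (0 : Fin (k + 1)), U i : ℕ) : ℝ) := by linarith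
    exact_mod_cast this
  -- Natural subtraction truncates: the number of observations taken is the larger of `B k` and `n₀
  -- * (k + 1)`, so both must stay below the sum.
  have hUsum' : n₀ * (k + 1) < ∑ i ∈ Finset.univ.erase (0 : Fin (k + 1)), U i := by
    have h1 : (n₀ : ℝ) * ((k + 1 : ℕ) : ℝ) ≤ r * ((k + 1 : ℕ) : ℝ) :=
      mul_le_mul_of_nonneg_right hn₀r (Nat.cast_nonneg _)
    have : ((n₀ * (k + 1) : ℕ) : ℝ) <
        ((∑ i ∈ Finset.univ.erase (0 : Fin (k + 1)), U i : ℕ) : ℝ) := by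
      rw [Nat.cast_mul]; linarith
    exact_mod_cast this
  change ¬ sampled (a k) n₀ _ (B k - n₀ * Fintype.card (Fin (k + 1))) = 0
  refine sampled_ne_of_lt_sum (N := N) (T := fun i => T i) (U := fun i => U i)
    (b := μ₁ - γ + σbar * q) (c := μ₁ - γ + σbar * p) (ha k).2 hN.1 ?_ ?_ ?_ ?_ ?_ ?_
  · simp only [hμ₁, hv₁, Fin.val_zero]
    rw [runAvg_scale _ _ _ (hn₀.trans hN.1), hsqrt₁, ← hlevel]
    have := mul_lt_mul_of_pos_left hqN.2.1 hσbar
    linarith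
  · simp only [hμ₁, hv₁, Fin.val_zero]
    intro n hn hnN
    rw [runAvg_scale _ _ _ (hn₀.trans hn), hsqrt₁, ← hlevel]
    have := mul_le_mul_of_nonneg_left (hpN.2.2 n hn hnN) hσbar.le
    linarith
  · intro i hi
    refine ⟨(hT i).1, ?_⟩
    rw [runAvg_scale _ _ _ (hn₀.trans (hT i).1), hsqrt, hgap k i hi]
    have := mul_lt_mul_of_pos_left (hT i).2.1 hσbar
    linarith
  · intro i hi n hn hnU
    rw [runAvg_scale _ _ _ (hn₀.trans hn), hsqrt, hgap k i hi]
    have := mul_le_mul_of_nonneg_left ((hU i).2.2 n hn hnU) hσbar.le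
    linarith
  · omega
  · rw [Fintype.card_fin]; omega

end Limit

end EFG

theorem theorem3
    -- the configurations: row `k` is a problem with `k + 1` alternatives, the best one is `0`
    (μ : ∀ k : ℕ, Fin (k + 1) → ℝ) (v : ∀ k : ℕ, Fin (k + 1) → ℝ≥0)
    (μ₁ : ℝ) (v₁ : ℝ≥0) (hμ₁ : ∀ k, μ k 0 = μ₁) (hv₁ : ∀ k, v k 0 = v₁)
    (γ σbar : ℝ) (hγ : 0 < γ) (hσbar : 0 < σbar)
    (hgap : ∀ k i, i ≠ 0 → γ ≤ μ₁ - μ k i)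
    (hvar : ∀ k i, (v k i : ℝ) ≤ σbar ^ 2)
    -- an arbitrary tie-breaking of the argmax
    (a : ∀ k : ℕ, (Fin (k + 1) → ℝ) → Fin (k + 1)) (ha : ∀ k, EFG.IsArgmaxRule (a k))
    (n₀ : ℕ) (hn₀ : 1 ≤ n₀) (n_g : ℝ)
    (hn_g : EFG.C (γ / σbar) n₀ < ENNReal.ofReal (n₀ + n_g))
    -- the budget is `n₀ + n_g` per alternative, up to rounding to an integer
    (B : ℕ → ℕ) (hB : ∀ k, |(B k : ℝ) - (n₀ + n_g) * ((k + 1 : ℕ) : ℝ)| < 1) :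
    (∃ γ₀ : ℝ, 0 < γ₀ ∧ γ₀ < γ ∧
      EFG.C ((γ - γ₀) / σbar) n₀ = ENNReal.ofReal (n₀ + n_g)) ∧
    ∀ γ₀ : ℝ, 0 < γ₀ → γ₀ < γ →
      EFG.C ((γ - γ₀) / σbar) n₀ = ENNReal.ofReal (n₀ + n_g) →
      EFG.probMinGT μ₁ v₁ n₀ (μ₁ - γ₀) ≤
        liminf (fun k => EFG.PCS (μ k) (v k) (a k) n₀ (B k)) atTop ∧
      ((∀ k i, i ≠ 0 → μ k i = μ₁ - γ) → (∀ k i, (v k i : ℝ) = σbar ^ 2) →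
        Tendsto (fun k => EFG.PCS (μ k) (v k) (a k) n₀ (B k)) atTop
          (𝓝 (EFG.probMinGT μ₁ v₁ n₀ (μ₁ - γ₀)))) := by
  have hr : 0 < n₀ + n_g := by
    by_contra h
    rw [ENNReal.ofReal_of_nonpos (not_lt.1 h)] at hn_g
    exact not_lt_zero hn_g
  refine ⟨?_, fun γ₀ _ hγ₀ hC => ⟨?_, fun hslip hcommon => ?_⟩⟩
  · obtain ⟨c, hc0, hc, hceq⟩ :=
      EFG.exists_C_eq hn₀ (div_pos hγ hσbar) ENNReal.ofReal_lt_top hn_g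
    rw [lt_div_iff₀ hσbar] at hc
    refine ⟨γ - c * σbar, by linarith, by linarith [mul_pos hc0 hσbar], ?_⟩
    rwa [sub_sub_cancel, mul_div_cancel_right₀ _ hσbar.ne']
  · simp only [EFG.PCS_eq _ _ (ha _).1, EFG.probMinGT_eq]
    set E := EFG.minGT μ₁ v₁ n₀ (μ₁ - γ₀)
    have hE : MeasurableSet E := EFG.measurableSet_minGT _ _ _ _
    -- Outside `E` nothing is known about the selection; intersecting with `E` gives an actual limit
    -- that bounds the liminf from below.
    have hlim : Tendsto
        (fun k => EFG.stdLaw (EFG.selectZero (μ k) (v k) (a k) n₀ (B k) ∩ E)) atTop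
        (𝓝 (EFG.stdLaw E)) := by
      refine tendsto_measure_of_ae_tendsto_indicator_of_isFiniteMeasure atTop hE
        (fun k => (EFG.measurableSet_selectZero _ _ (ha k).1 _ _).inter hE) ?_
      filter_upwards [EFG.ae_eventually_mem_selectZero hμ₁ hv₁ hγ hσbar hgap hvar ha hn₀ hB hγ₀ hC]
        with ω hω
      by_cases hωE : ω ∈ E
      · filter_upwards [hω hωE] with k hk using ⟨fun _ => hωE, fun _ => ⟨hk, hωE⟩⟩
      · exact Eventually.of_forall fun k => ⟨fun h => h.2, fun h => absurd h hωE⟩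
    rw [← hlim.liminf_eq]
    exact liminf_le_liminf (Eventually.of_forall fun k => measure_mono Set.inter_subset_left)
  · simp only [EFG.PCS_eq _ _ (ha _).1, EFG.probMinGT_eq]
    refine tendsto_measure_of_ae_tendsto_indicator_of_isFiniteMeasure atTop
      (EFG.measurableSet_minGT _ _ _ _) (fun k => EFG.measurableSet_selectZero _ _ (ha k).1 _ _) ?_
    filter_upwards [EFG.ae_eventually_mem_selectZero hμ₁ hv₁ hγ hσbar hgap hvar ha hn₀ hB hγ₀ hC,
      EFG.ae_eventually_notMem_selectZero hμ₁ hv₁ hγ hσbar hslip hcommon ha hn₀ hB hγ₀ hC hr]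
      with ω h1 h2
    by_cases hω : ω ∈ EFG.minGT μ₁ v₁ n₀ (μ₁ - γ₀)
    · filter_upwards [h1 hω] with k hk using iff_of_true hk hω
    · filter_upwards [h2 hω] with k hk using iff_of_false hk hω
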